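/- Let $R$ be a regular local ring and let $S$ be a regular local ring that is a finite extension of $R$; that is, $S$ is an $R$-algebra for which $R\to S$ is injective and $S$ is finitely generated as an $R$-module. Suppose there exists a prime ideal $\mathfrak q_0\subset S$ of height $1$ such that the induced ring homomorphism $R/(\mathfrak q_0\cap R)\to S/\mathfrak q_0$ is étale. Then $S$ is monogenic over $R$, i.e., there exists an element $\beta\in S$ such that $R[\beta]=S$. -/

import Mathlib

open IsLocalRing

/-! Étaleness modulo `q₀` gives `m_S = m_R S + q₀` and a separable residue field extension.
Regularity of `S` makes `q₀` negligible or principal: if `q₀ ≤ m_S ^ 2`, Nakayama gives `m_S = m_R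
S`; otherwise `q₀` contains a minimal generator of `m_S`, which spans a nonzero prime and hence all
of `q₀`. Either way `m_S = m_R S + (t)`. A suitable lift `β` of a primitive residue element then
makes some `f(β)` replace `t`, so `R[β]` fills `S` modulo `m_R S`, and Nakayama concludes. -/

theorem IsLocalRing.maximalIdeal_le_of_le_sup_sq {A : Type*} [CommRing A] [IsLocalRing A]
    [IsNoetherianRing A] {I : Ideal A} (h : maximalIdeal A ≤ I ⊔ maximalIdeal A ^ 2) :
    maximalIdeal A ≤ I := by
  refine Submodule.le_of_le_smul_of_le_jacobson_bot (I := maximalIdeal A)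
    (IsNoetherian.noetherian _) (jacobson_eq_maximalIdeal _ bot_ne_top).ge ?_
  rwa [smul_eq_mul, ← pow_two]

/-- A minimal generator of the maximal ideal extends to a generating set of minimal size. -/
theorem IsLocalRing.exists_span_insert_eq_maximalIdeal {A : Type*} [CommRing A] [IsLocalRing A]
    [IsNoetherianRing A] {x : A} (hx : x ∈ maximalIdeal A) (hx2 : x ∉ maximalIdeal A ^ 2) :
    ∃ s : Set A, s.Finite ∧ Ideal.span (insert x s) = maximalIdeal A ∧
      s.ncard + 1 ≤ (maximalIdeal A).spanFinrank := by
  let m := maximalIdeal A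
  let v : CotangentSpace A := m.toCotangent ⟨x, hx⟩
  have hv : v ≠ 0 := fun h ↦ hx2 ((m.toCotangent_eq_zero _).mp h)
  have hli : LinearIndepOn (ResidueField A) id {v} := LinearIndepOn.singleton hv
  let b := Module.Basis.extend hli
  set B : Set (CotangentSpace A) := hli.extend (Set.subset_univ _) with hB
  have hvB : v ∈ B := hli.subset_extend _ rfl
  have hBfin : B.Finite := Module.Finite.finite_basis b
  have hcard : B.ncard = m.spanFinrank := by
    rw [spanFinrank_maximalIdeal_eq_finrank_cotangentSpace, Module.finrank_eq_nat_card_basis b]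
    rfl
  obtain ⟨g, hg⟩ := m.toCotangent_surjective.hasRightInverse
  let T : Set m := insert ⟨x, hx⟩ (g '' (B \ {v}))
  have hT : Submodule.span A T = ⊤ := by
    rw [← CotangentSpace.span_image_eq_top_iff]
    have : m.toCotangent '' T = B := by
      rw [Set.image_insert_eq, ← Set.image_comp, hg.id, Set.image_id, Set.insert_sdiff_singleton,
        Set.insert_eq_of_mem hvB]
    rw [this, hB, hli.span_extend_eq_span, Submodule.span_univ]
  refine ⟨(fun z ↦ (g z : A)) '' (B \ {v}), (hBfin.subset Set.sdiff_subset).image _, ?_, ?_⟩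
  · have h := congrArg (Submodule.map m.subtype) hT
    rw [Submodule.map_span, Submodule.map_top, Submodule.range_subtype, Set.image_insert_eq,
      ← Set.image_comp] at h
    exact h
  · have h1 := Set.ncard_image_le (f := fun z ↦ (g z : A))
      (hBfin.subset (Set.sdiff_subset (t := {v})))
    have h2 := Set.ncard_sdiff_singleton_add_one hvB hBfin
    change _ ≤ m.spanFinrank
    omega

/-- Killing a minimal generator lowers the embedding dimension by at least one, while the Krull
dimension drops by at most one. -/
theorem IsRegularLocalRing.quotient_span_singleton {A : Type*} [CommRing A]
    [IsRegularLocalRing A] {x : A} (hx : x ∈ maximalIdeal A) (hx2 : x ∉ maximalIdeal A ^ 2) :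
    ∃ _ : IsRegularLocalRing (A ⧸ Ideal.span {x}),
      (maximalIdeal (A ⧸ Ideal.span {x})).spanFinrank < (maximalIdeal A).spanFinrank := by
  have : Nontrivial (A ⧸ Ideal.span {x}) := Ideal.Quotient.nontrivial_iff.mpr
    (ne_top_of_le_ne_top (maximalIdeal.isMaximal A).ne_top
      ((Ideal.span_singleton_le_iff_mem _).mpr hx))
  have hloc : IsLocalRing (A ⧸ Ideal.span {x}) :=
    IsLocalRing.of_surjective' (Ideal.Quotient.mk _) Ideal.Quotient.mk_surjective
  have : IsLocalHom (Ideal.Quotient.mk (Ideal.span {x})) :=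
    IsLocalHom.of_surjective _ Ideal.Quotient.mk_surjective
  obtain ⟨s, hs, hspan, hcard⟩ := exists_span_insert_eq_maximalIdeal hx hx2
  have hmax : maximalIdeal (A ⧸ Ideal.span {x}) = Ideal.span (Ideal.Quotient.mk _ '' s) := by
    have h1 : (maximalIdeal A).map (Ideal.Quotient.mk (Ideal.span {x})) =
        maximalIdeal (A ⧸ Ideal.span {x}) := by
      refine le_antisymm (((local_hom_TFAE (Ideal.Quotient.mk (Ideal.span {x}))).out 0 2).mp ‹_›) ?_
      intro y hy
      obtain ⟨y, rfl⟩ := Ideal.Quotient.mk_surjective y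
      exact Ideal.mem_map_of_mem _ ((mem_maximalIdeal _).mpr fun h ↦
        (mem_maximalIdeal _).mp hy (h.map _))
    rw [← h1, ← hspan, Ideal.map_span, Set.image_insert_eq, Ideal.Quotient.mk_singleton_self,
      Ideal.span_insert_zero]
  have hle : (maximalIdeal (A ⧸ Ideal.span {x})).spanFinrank ≤ s.ncard := by
    rw [hmax]
    exact (Submodule.spanFinrank_span_le_ncard_of_finite (hs.image _)).trans
      (Set.ncard_image_le hs)
  refine ⟨IsRegularLocalRing.of_spanFinrank_maximalIdeal_le _ ?_, by omega⟩
  have hdim := Ideal.height_le_ringKrullDim_quotient_add_one hx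
  rw [maximalIdeal_height_eq_ringKrullDim, ← IsRegularLocalRing.spanFinrank_maximalIdeal] at hdim
  have h3 : (((maximalIdeal (A ⧸ Ideal.span {x})).spanFinrank + 1 : ℕ) : WithBot ℕ∞) ≤
      ringKrullDim (A ⧸ Ideal.span {x}) + 1 :=
    le_trans (by exact_mod_cast (by omega)) hdim
  obtain h | ⟨d, h⟩ : ringKrullDim (A ⧸ Ideal.span {x}) = ⊥ ∨
      ∃ d : ℕ∞, (d : WithBot ℕ∞) = ringKrullDim (A ⧸ Ideal.span {x}) := by
    cases h : ringKrullDim (A ⧸ Ideal.span {x}) with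
    | bot => exact .inl rfl
    | coe d => exact .inr ⟨d, rfl⟩
  · exact absurd h ringKrullDim_ne_bot
  · rw [← h] at h3 ⊢
    have h4 : (((maximalIdeal (A ⧸ Ideal.span {x})).spanFinrank : ℕ∞)) + 1 ≤ d + 1 := by
      exact_mod_cast h3
    have := (ENat.add_le_add_iff_right (by simp)).mp h4
    exact_mod_cast this

/-- Induction on embedding dimension: for `x` outside `m ^ 2` and all minimal primes, `(x)` is
prime. A minimal prime `P ≤ (x)` satisfies `P = xP`, so it vanishes by Nakayama. -/
theorem IsRegularLocalRing.isDomain (A : Type*) [CommRing A] [IsRegularLocalRing A] :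
    IsDomain A := by
  induction hn : (maximalIdeal A).spanFinrank using Nat.strong_induction_on generalizing A with
  | _ n ih =>
  by_cases hf : IsField A
  · exact hf.isDomain
  obtain ⟨x, hx, hx'⟩ : ∃ x ∈ maximalIdeal A,
      x ∉ ⋃ I ∈ insert (maximalIdeal A ^ 2) (minimalPrimes A), (I : Set A) := by
    by_contra! h
    -- Prime avoidance allows two non-prime ideals; `m ^ 2` takes both slots.
    obtain ⟨I, hI, hle⟩ := (Ideal.subset_union_prime_finite
      (f := id) ((minimalPrimes.finite_of_isNoetherianRing A).insert (maximalIdeal A ^ 2))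
      (maximalIdeal A ^ 2) (maximalIdeal A ^ 2)
      (fun I hI h1 _ ↦ (hI.resolve_left h1).1.1)).mp h
    obtain rfl | hI := hI
    · have := maximalIdeal_le_of_le_sup_sq (A := A) (I := ⊥) (by simpa using hle)
      exact hf (isField_iff_maximalIdeal_eq.mpr (le_bot_iff.mp this))
    · have := hI.1.1
      have hIm : I = maximalIdeal A := le_antisymm (le_maximalIdeal this.ne_top) hle
      have h0 : (maximalIdeal A).height = 0 := by
        rw [← hIm, Ideal.height_eq_zero_iff]
        exact hI
      have h1 := IsRegularLocalRing.spanFinrank_maximalIdeal (R := A)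
      rw [← maximalIdeal_height_eq_ringKrullDim, h0] at h1
      have h2 : (maximalIdeal A).spanFinrank = 0 := by exact_mod_cast h1
      rw [Submodule.spanFinrank_eq_zero_iff_eq_bot (IsNoetherian.noetherian _)] at h2
      exact hf (isField_iff_maximalIdeal_eq.mpr h2)
  simp only [Set.mem_iUnion, not_exists, Set.mem_insert_iff, forall_eq_or_imp, SetLike.mem_coe]
    at hx'
  obtain ⟨hreg, hlt⟩ := quotient_span_singleton hx hx'.1
  have := ih _ (hn ▸ hlt) (A ⧸ Ideal.span {x}) rfl
  have hprime : (Ideal.span {x}).IsPrime := (Ideal.Quotient.isDomain_iff_prime _).mp this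
  obtain ⟨P, hP, hPx⟩ := Ideal.exists_minimalPrimes_le (bot_le : ⊥ ≤ Ideal.span {x})
  have hPprime := hP.1.1
  have hxP : x ∉ P := hx'.2 P hP
  have hbot : P = ⊥ := by
    refine Submodule.eq_bot_of_le_smul_of_le_jacobson_bot (maximalIdeal A) P
      (IsNoetherian.noetherian _) ?_ (jacobson_eq_maximalIdeal _ bot_ne_top).ge
    intro y hy
    obtain ⟨z, rfl⟩ := Ideal.mem_span_singleton'.mp (hPx hy)
    rw [mul_comm]
    exact Submodule.smul_mem_smul hx ((hPprime.mem_or_mem hy).resolve_right hxP)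
  rw [hbot] at hPprime
  exact IsDomain.of_bot_isPrime A

/-- A height one prime of a regular local ring is either contained in the square of the maximal
ideal or generated by a minimal generator of the maximal ideal. -/
theorem IsRegularLocalRing.le_sq_or_exists_eq_span_singleton {A : Type*} [CommRing A]
    [IsRegularLocalRing A] (q : Ideal A) [q.IsPrime] (hq : q.height = 1) :
    q ≤ maximalIdeal A ^ 2 ∨ ∃ t, q = Ideal.span {t} := by
  by_contra! h
  obtain ⟨t, ht, ht2⟩ := SetLike.not_le_iff_exists.mp h.1
  obtain ⟨_, -⟩ := (quotient_span_singleton (le_maximalIdeal (Ideal.IsPrime.ne_top ‹_›) ht) ht2)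
  have hdom := IsRegularLocalRing.isDomain (A ⧸ Ideal.span {t})
  have hA := IsRegularLocalRing.isDomain A
  have hprime : (Ideal.span {t}).IsPrime := (Ideal.Quotient.isDomain_iff_prime _).mp hdom
  have hlt : Ideal.span {t} < q :=
    lt_of_le_of_ne ((Ideal.span_singleton_le_iff_mem _).mpr ht) (h.2 t).symm
  have hlt0 : ⊥ < Ideal.span {t} := bot_lt_iff_ne_bot.mpr fun h0 ↦ ht2 <| by
    simp [Ideal.span_singleton_eq_bot.mp h0]
  have h1 := Ideal.height_add_one_le_of_lt_of_isPrime hlt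
  have h0 := Ideal.height_add_one_le_of_lt_of_isPrime hlt0
  rw [hq] at h1
  rw [Ideal.height_bot, zero_add] at h0
  have h2 : (1 : ℕ∞) + 1 ≤ 1 := le_trans (by gcongr) h1
  exact absurd h2 (by decide)

open Polynomial in
/-- A lift of a primitive element of the residue field extension that also produces, via a lift of
its minimal polynomial, a generator of the maximal ideal modulo the base. -/
theorem IsLocalRing.exists_primitive_lift {R S : Type*} [CommRing R] [CommRing S] [Algebra R S]
    [IsLocalRing R] [IsLocalRing S] [IsNoetherianRing S] [Module.Finite R S]
    [IsLocalHom (algebraMap R S)] [Algebra.IsSeparable (ResidueField R) (ResidueField S)]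
    {N : Ideal S} {t : S} (ht : t ∈ maximalIdeal S)
    (hmax : maximalIdeal S ≤ N ⊔ Ideal.span {t}) :
    ∃ (β : S) (f : R[X]),
      Algebra.adjoin (ResidueField R) {residue S β} = ⊤ ∧ aeval β f ∈ maximalIdeal S ∧
      maximalIdeal S ≤ N ⊔ Ideal.span {aeval β f} := by
  obtain ⟨α, hα⟩ := Field.exists_primitive_element (ResidueField R) (ResidueField S)
  have hαint : IsIntegral (ResidueField R) α := Algebra.IsIntegral.isIntegral α
  have hadj : Algebra.adjoin (ResidueField R) {α} = ⊤ := by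
    rw [← IntermediateField.adjoin_simple_toSubalgebra_of_isAlgebraic hαint.isAlgebraic, hα]
    rfl
  obtain ⟨b, rfl⟩ := residue_surjective α
  obtain ⟨f, hf⟩ := Polynomial.map_surjective (residue R) residue_surjective
    (minpoly (ResidueField R) (residue S b))
  have hres (g : R[X]) : residue S (aeval b g) = aeval (residue S b) (g.map (residue R)) := by
    rw [← ResidueField.algebraMap_eq R, aeval_map_algebraMap, ← ResidueField.algebraMap_eq S,
      aeval_algebraMap_apply]
  have hfb : aeval b f ∈ maximalIdeal S := by
    rw [← residue_eq_zero_iff, hres, hf, minpoly.aeval]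
  have hf' : IsUnit (aeval b (derivative f)) := by
    rw [← residue_ne_zero_iff_isUnit, hres, ← derivative_map, hf]
    exact (Algebra.IsSeparable.isSeparable (ResidueField R) _).aeval_derivative_ne_zero
      (minpoly.aeval _ _)
  obtain ⟨n, hn, s, hs, hns⟩ := Submodule.mem_sup.mp (hmax hfb)
  obtain ⟨u, rfl⟩ := Ideal.mem_span_singleton'.mp hs
  -- Here `f(b) = n + u * t`. If `u` is not a unit, shift `b` by `t`: modulo `m ^ 2`, `f(b + t) ≡ n
  -- + f'(b) * t`, and `f'(b)` is a unit by separability.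
  by_cases hu : IsUnit u
  · refine ⟨b, f, hadj, hfb, hmax.trans (sup_le le_sup_left ?_)⟩
    rw [Ideal.span_singleton_le_iff_mem, ← Ideal.unit_mul_mem_iff_mem _ hu]
    have : u * t = aeval b f - n := by rw [← hns]; ring
    rw [this]
    exact sub_mem (Ideal.mem_sup_right (Ideal.mem_span_singleton_self _)) (Ideal.mem_sup_left hn)
  · obtain ⟨k, hk⟩ := (f.map (algebraMap R S)).binomExpansion b t
    simp only [derivative_map, eval_map_algebraMap] at hk
    refine ⟨b + t, f, ?_, ?_, ?_⟩
    · rwa [map_add, (residue_eq_zero_iff t).mpr ht, add_zero]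
    · rw [hk]
      exact add_mem (add_mem hfb (Ideal.mul_mem_left _ _ ht))
        (Ideal.mul_mem_left _ _ (Ideal.pow_mem_of_mem _ ht 2 two_pos))
    apply maximalIdeal_le_of_le_sup_sq
    refine hmax.trans (sup_le (le_sup_left.trans le_sup_left) ?_)
    rw [Ideal.span_singleton_le_iff_mem, ← Ideal.unit_mul_mem_iff_mem _ hf']
    have : aeval b (derivative f) * t =
        aeval (b + t) f - n - (u * t + k * t ^ 2) := by rw [hk, ← hns]; ring
    rw [this]
    refine sub_mem (sub_mem (Ideal.mem_sup_left
      (Ideal.mem_sup_right (Ideal.mem_span_singleton_self _)))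
      (Ideal.mem_sup_left (Ideal.mem_sup_left hn))) (Ideal.mem_sup_right (add_mem ?_ ?_))
    · rw [pow_two]
      exact Ideal.mul_mem_mul hu ht
    · exact Ideal.mul_mem_left _ _ (Ideal.pow_mem_pow ht 2)

/-- A finite local extension with separable residue field extension, whose closed fibre has
principal maximal ideal, is monogenic. -/
theorem IsLocalRing.exists_adjoin_singleton_eq_top {R S : Type*} [CommRing R] [CommRing S]
    [Algebra R S] [IsLocalRing R] [IsNoetherianRing R] [IsLocalRing S] [IsNoetherianRing S]
    [Module.Finite R S] [IsLocalHom (algebraMap R S)]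
    [Algebra.IsSeparable (ResidueField R) (ResidueField S)]
    {t : S} (ht : t ∈ maximalIdeal S)
    (hmax : maximalIdeal S ≤ (maximalIdeal R).map (algebraMap R S) ⊔ Ideal.span {t}) :
    ∃ β : S, Algebra.adjoin R {β} = ⊤ := by
  obtain ⟨β, f, hβ, hgm, hf⟩ := exists_primitive_lift (R := R) ht hmax
  refine ⟨β, ?_⟩
  set N := (maximalIdeal R).map (algebraMap R S) with hN
  set B := Algebra.adjoin R {β} with hB
  set g := Polynomial.aeval β f with hg
  have hgB : g ∈ B := Polynomial.aeval_mem_adjoin_singleton R β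
  have hsurj (s : S) : ∃ b ∈ B, s - b ∈ maximalIdeal S := by
    have h : residue S s ∈ Algebra.adjoin (ResidueField R) {residue S β} := hβ ▸ Algebra.mem_top
    obtain ⟨p, hp⟩ := (Algebra.adjoin_singleton_eq_range_aeval (ResidueField R) (residue S β)) ▸ h
    obtain ⟨p, rfl⟩ := Polynomial.map_surjective (residue R) residue_surjective p
    refine ⟨Polynomial.aeval β p, Polynomial.aeval_mem_adjoin_singleton R β, ?_⟩
    rw [← residue_eq_zero_iff, map_sub, sub_eq_zero, ← hp]
    change Polynomial.aeval _ _ = _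
    rw [← ResidueField.algebraMap_eq R, Polynomial.aeval_map_algebraMap,
      ← ResidueField.algebraMap_eq S, Polynomial.aeval_algebraMap_apply]
  -- Expansion in powers of `g` modulo `N`, with coefficients in `B`.
  have hpow (n : ℕ) (s : S) : ∃ b ∈ B, ∃ c, s - b - g ^ n * c ∈ N := by
    induction n with
    | zero => exact ⟨0, zero_mem _, s, by simp⟩
    | succ n ih =>
      obtain ⟨b, hb, c, hc⟩ := ih
      obtain ⟨b', hb', hcb⟩ := hsurj c
      obtain ⟨y, hy, z, hz, hyz⟩ := Submodule.mem_sup.mp (hf hcb)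
      obtain ⟨w, rfl⟩ := Ideal.mem_span_singleton'.mp hz
      refine ⟨b + g ^ n * b', add_mem hb (mul_mem (pow_mem hgB n) hb'), w, ?_⟩
      have : s - (b + g ^ n * b') - g ^ (n + 1) * w = s - b - g ^ n * c + g ^ n * y := by
        linear_combination -g ^ n * hyz
      rw [this]
      exact add_mem hc (Ideal.mul_mem_left _ _ hy)
  -- The closed fibre is finite over a field, hence Artinian, so the remainder `g ^ n * c`
  -- eventually lies in `N`.
  have hart : ∃ n, maximalIdeal S ^ n ≤ N := by
    let : Algebra (ResidueField R) (S ⧸ N) :=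
      (inferInstance : Algebra (R ⧸ maximalIdeal R) (S ⧸ N))
    have : IsScalarTower R (ResidueField R) (S ⧸ N) :=
      (inferInstance : IsScalarTower R (R ⧸ maximalIdeal R) (S ⧸ N))
    have : Module.Finite (ResidueField R) (S ⧸ N) := .of_restrictScalars_finite R _ _
    have : IsArtinianRing (S ⧸ N) := isArtinian_of_tower (ResidueField R) inferInstance
    exact exists_maximalIdeal_pow_le_of_isArtinianRing_quotient N
  obtain ⟨n, hn⟩ := hart
  have htop : (⊤ : Submodule R S) ≤ Subalgebra.toSubmodule B ⊔ maximalIdeal R • ⊤ := by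
    intro s _
    obtain ⟨b, hb, c, hc⟩ := hpow n s
    have hs : s - b ∈ N := by
      have := add_mem hc (Ideal.mul_mem_right c _ (hn (Ideal.pow_mem_pow hgm n)))
      simpa using this
    rw [← add_sub_cancel b s]
    refine Submodule.add_mem_sup hb ?_
    rw [Ideal.smul_top_eq_map]
    exact hs
  have := Submodule.le_of_le_smul_of_le_jacobson_bot Module.Finite.fg_top
    (jacobson_eq_maximalIdeal _ bot_ne_top).ge htop
  exact Algebra.toSubmodule_eq_top.mp (top_le_iff.mp this)

theorem mainTheorem5 {R : Type*} {S : Type*} [CommRing R] [CommRing S] [Algebra R S]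
    [IsRegularLocalRing R] [IsRegularLocalRing S] [Module.Finite R S]
    (hRS : Function.Injective (algebraMap R S))
    (q₀ : Ideal S) [q₀.IsPrime] (hq₀ : q₀.height = 1)
    (hetale : Algebra.Etale (R ⧸ q₀.under R) (S ⧸ q₀)) :
    ∃ β : S, Algebra.adjoin R {β} = ⊤ := by
  have hq : q₀ ≠ ⊤ := Ideal.IsPrime.ne_top ‹_›
  have hlocal : IsLocalHom (algebraMap R S) := by
    have := ((faithfulSMul_iff_algebraMap_injective R S).mpr hRS)
    infer_instance
  have : IsLocalRing (S ⧸ q₀) :=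
    .of_surjective' (Ideal.Quotient.mk q₀) Ideal.Quotient.mk_surjective
  have : IsLocalHom (Ideal.Quotient.mk q₀) := .of_surjective _ Ideal.Quotient.mk_surjective
  have : IsLocalHom (algebraMap R (S ⧸ q₀)) :=
    RingHom.isLocalHom_comp (Ideal.Quotient.mk q₀) (algebraMap R S)
  have : Algebra.FormallyUnramified R (S ⧸ q₀) := .comp R (R ⧸ q₀.under R) _
  have hmap := Algebra.FormallyUnramified.map_maximalIdeal (R := R) (S := S ⧸ q₀)
  have hsup : maximalIdeal S ≤ (maximalIdeal R).map (algebraMap R S) ⊔ q₀ := by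
    intro s hs
    have h : Ideal.Quotient.mk q₀ s ∈ maximalIdeal (S ⧸ q₀) :=
      (mem_maximalIdeal _).mpr fun h ↦ (mem_maximalIdeal _).mp hs (isUnit_of_map_unit _ _ h)
    rw [← hmap, IsScalarTower.algebraMap_eq R S (S ⧸ q₀), ← Ideal.map_map] at h
    exact Ideal.mem_quotient_iff_mem_sup.mp h
  have hsep : Algebra.IsSeparable (ResidueField R) (ResidueField S) := by
    have : Algebra.FormallyUnramified R (ResidueField S) :=
      .of_surjective (Ideal.Quotient.factorₐ R (le_maximalIdeal hq))
        (Ideal.Quotient.factor_surjective (le_maximalIdeal hq))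
    have : Algebra.FormallyUnramified (ResidueField R) (ResidueField S) := .of_restrictScalars R _ _
    exact Algebra.FormallyUnramified.isSeparable _ _
  obtain h | ⟨t, rfl⟩ := IsRegularLocalRing.le_sq_or_exists_eq_span_singleton q₀ hq₀
  · refine exists_adjoin_singleton_eq_top (t := 0) (zero_mem _) (le_sup_of_le_left ?_)
    exact maximalIdeal_le_of_le_sup_sq (hsup.trans (sup_le_sup_left h _))
  · exact exists_adjoin_singleton_eq_top (le_maximalIdeal hq (Ideal.mem_span_singleton_self t)) hsup
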